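/- Let $\mathbb K$ be $\mathbb R$ or $\mathbb C$ and let $n$ be a natural number; all spaces are Banach spaces over $\mathbb K$, $X'$ denotes the dual of $X$, $T'$ the adjoint of an operator $T$, and $\mathcal P^n(E)$ is the space of continuous scalar valued $n$-homogeneous polynomials on $E$. A *Banach ideal $(\mathcal Q,\|\cdot\|_{\mathcal Q})$ of continuous $n$-homogeneous polynomials* assigns to each $E$ a linear subspace $\mathcal Q(E)\subset\mathcal P^n(E)$ with a complete norm such that $p\circ T\in\mathcal Q(E)$ and $\|p\circ T\|_{\mathcal Q}\le\|p\|_{\mathcal Q}\|T\|^n$ for $T\in\mathcal L(E,F)$, $p\in\mathcal Q(F)$, and such that $z\mapsto z^n$ belongs to $\mathcal Q(\mathbb K)$ with norm $1$. A *Banach operator ideal* $(\mathfrak A,\|\cdot\|_{\mathfrak A})$ assigns to each pair $(E,F)$ a linear subspace $\mathfrak A(E,F)\subset\mathcal L(E,F)$ with a complete norm such that $RTS\in\mathfrak A$ with $\|RTS\|_{\mathfrak A}\le\|R\|\,\|T\|_{\mathfrak A}\|S\|$ for $T \in \mathfrak A$ and bounded $R,S$, and such that $\mathrm{id}_{\mathbb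 K}\in\mathfrak A$ with norm $1$. Its dual ideal is $\mathfrak A^{dual}(E,F)=\{T: T'\in\mathfrak A(F',E')\}$ with $\|T\|_{\mathfrak A^{dual}}=\|T'\|_{\mathfrak A}$. $\mathfrak A$ is *maximal* if, for every $T\in\mathcal L(E,F)$, $T\in\mathfrak A$ if and only if $s(T):=\sup\|Q_L\circ T\circ I_M\|_{\mathfrak A}<\infty$, and then $\|T\|_{\mathfrak A}=s(T)$; here the supremum is over all inclusions $I_M:M\to E$ of finite dimensional subspaces and all quotient maps $Q_L:F\to F/L$ by closed finite codimensional subspaces. $\mathfrak A$ is *right-accessible* if for all $T\in\mathcal L(M,F)$ with $\dim M<\infty$ and all $\varepsilon>0$ there are a finite dimensional subspace $N\subset F$ and $S\in\mathcal L(M,N)$ with $T=I_N\circ S$ and $\|S\|_{\mathfrak A}\le(1+\varepsilon)\|T\|_{\mathfrak A}$. It is *left-accessible* if for all $T\in\mathcal L(E,N)$ with $\dim N<\infty$ and all $\varepsilon>0$ there are a closed finite codimensional subspace $L\subset E$ and $S\in\mathcal L(E/L,N)$ with $T=S\circ Q_L$ and $\|S\|_{\mathfrak A}\le(1+\varepsilon)\|T\|_{\mathfrak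 A}$. It is *accessible* if it is both. For a finite dimensional $M$, $\langle\cdot,\cdot\rangle$ is the bilinear form on $\mathcal P^n(M)\times\mathcal P^n(M')$ with $\langle (x')^n,x^n\rangle=x'(x)^n$ for $x' \in M'$, $x \in M$. Each of the following three classes consists of the polynomials in $\mathcal P^n(E)$, $E$ any Banach space, for which the indicated norm is finite. * The adjoint of a class $\mathcal R$ of $n$-homogeneous polynomials on which $\|\cdot\|_{\mathcal R}\ge 0$ is given: $\|q\|_{\mathcal R^*}=\sup\{|\langle q|_M,p\rangle| : M\subset E,\ \dim M<\infty,\ p\in\mathcal R(M'),\ \|p\|_{\mathcal R}\le1\}$. * $\|p\|_{\mathcal Q\circ\mathfrak A}=\inf\{\|q\|_{\mathcal Q}\|T\|_{\mathfrak A}^n : p=q\circ T,\ T\in\mathfrak A(E,F),\ q\in\mathcal Q(F)\}$ ($=\infty$ if there is no such factorization). * $\|p\|_{\mathcal R\circ\mathfrak B^{-1}}=\sup\{\|p\circ T\|_{\mathcal R} : T\in\mathfrak B(G,E),\ \|T\|_{\mathfrak B}\le1\}$ for an operator ideal $\mathfrak B$, where $G$ ranges over all Banach spaces and $\|p \circ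 T\|_{\mathcal R}=\infty$ if $p\circ T\notin\mathcal R$. **Proposition.** Let $\mathcal Q$ be a Banach ideal of continuous $n$-homogeneous polynomials and $\mathfrak A$ a Banach operator ideal. If $\mathfrak A$ is maximal and accessible, or if $\mathfrak A$ and $\mathfrak A^{dual}$ are both right-accessible, then $$(\mathcal Q\circ\mathfrak A)^*=\mathcal Q^*\circ(\mathfrak A^{dual})^{-1}\quad\text{isometrically,}$$ that is, for every Banach space $E$ the two classes contain the same $p\in\mathcal P^n(E)$, with equal norms. -/

import Mathlib

open scoped ENNReal NNReal Topology

universe u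

namespace BanachIdeals

/-! ### Continuous homogeneous polynomials -/

section Polynomials

variable (𝕜 : Type*) [RCLike 𝕜] (n : ℕ)

/-- `HomPoly 𝕜 n E`: the space of continuous scalar valued `n`-homogeneous polynomials on `E`, i.e.
of the functions `x ↦ f (x, …, x)` with `f` a continuous `n`-linear form. -/
def HomPoly (E : Type*) [NormedAddCommGroup E] [NormedSpace 𝕜 E] : Submodule 𝕜 (E → 𝕜) where
  carrier := {p | ∃ f : ContinuousMultilinearMap 𝕜 (fun _ : Fin n => E) 𝕜, ∀ x, p x = f fun _ => x}
  add_mem' := by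
    rintro p q ⟨f, hf⟩ ⟨g, hg⟩
    exact ⟨f + g, fun x => by simp [hf, hg]⟩
  zero_mem' := ⟨0, fun x => by simp⟩
  smul_mem' := by
    rintro c p ⟨f, hf⟩
    exact ⟨c • f, fun x => by simp [hf]⟩

variable {𝕜 n}
variable {E F : Type*} [NormedAddCommGroup E] [NormedSpace 𝕜 E]
  [NormedAddCommGroup F] [NormedSpace 𝕜 F]

/-- The composition `p ∘ T`. -/
def polyComp (p : HomPoly 𝕜 n F) (T : E →L[𝕜] F) : HomPoly 𝕜 n E :=
  ⟨fun x => (p : F → 𝕜) (T x), by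
    obtain ⟨f, hf⟩ := p.2
    exact ⟨f.compContinuousLinearMap fun _ => T, fun x => by simp [hf]⟩⟩

/-- The `n`-th power `x ↦ (φ x) ^ n` of a continuous linear form `φ`. -/
def powForm (n : ℕ) (φ : StrongDual 𝕜 E) : HomPoly 𝕜 n E :=
  ⟨fun x => φ x ^ n,
    (ContinuousMultilinearMap.mkPiAlgebraFin 𝕜 n 𝕜).compContinuousLinearMap fun _ => φ,
    fun x => by simp [List.ofFn_const]⟩

/-- The `n`-th power `φ ↦ (φ x) ^ n` of a point `x`, as a polynomial on the dual. -/
noncomputable def powPoint (n : ℕ) (x : E) : HomPoly 𝕜 n (StrongDual 𝕜 E) :=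
  powForm n (ContinuousLinearMap.apply 𝕜 𝕜 x)

end Polynomials

/-! ### Trace duality -/

section TraceDuality

theorem factorial_mul_prod_eq {R : Type*} [CommRing R] (n : ℕ) (a : Fin n → R) :
    (n.factorial : R) * ∏ i, a i =
      ∑ t : Finset (Fin n), (-1 : R) ^ t.card * (∑ j ∈ tᶜ, a j) ^ n := by
  classical
  have h1 : ∀ t : Finset (Fin n), (∑ j ∈ tᶜ, a j) ^ n =
      ∑ g : Fin n → Fin n, (∏ j ∈ t, (if j ∈ Set.range g then (0 : R) else 1)) *
        ∏ i, a (g i) := by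
    intro t
    have e1 : (∑ j ∈ tᶜ, a j) = ∑ j, if j ∈ t then 0 else a j := by
      have : ∀ j, (if j ∈ t then 0 else a j) = if j ∈ tᶜ then a j else 0 := by
        intro j; by_cases hj : j ∈ t <;> simp [hj]
      rw [Finset.sum_congr rfl fun j _ => this j, Finset.sum_ite_mem, Finset.univ_inter]
    have e2 : (∑ j, if j ∈ t then 0 else a j) ^ n
        = ∏ _i : Fin n, ∑ j, if j ∈ t then 0 else a j := by simp
    rw [e1, e2, Finset.prod_univ_sum, Fintype.piFinset_univ]
    refine Finset.sum_congr rfl fun g _ => ?_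
    by_cases hg : ∃ i, g i ∈ t
    · obtain ⟨i, hi⟩ := hg
      rw [Finset.prod_eq_zero (Finset.mem_univ i) (by simp [hi]),
        Finset.prod_eq_zero hi (by simp), zero_mul]
    · push Not at hg
      have k1 : ∀ j ∈ t, (if j ∈ Set.range g then (0 : R) else 1) = 1 := by
        intro j hj
        rw [if_neg]
        rintro ⟨i, rfl⟩
        exact hg i hj
      rw [Finset.prod_congr rfl k1, Finset.prod_const_one, one_mul]
      exact Finset.prod_congr rfl fun i _ => by simp [hg i]
  have h2 : ∀ g : Fin n → Fin n,
      ∑ t : Finset (Fin n), (-1 : R) ^ t.card *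
        (∏ j ∈ t, (if j ∈ Set.range g then (0 : R) else 1)) =
      if Function.Bijective g then 1 else 0 := by
    intro g
    have := Finset.prod_sub (fun _ : Fin n => (1 : R))
      (fun j => if j ∈ Set.range g then (0 : R) else 1) Finset.univ
    simp only [Finset.prod_const_one, mul_one, Finset.powerset_univ] at this
    rw [← this]
    split_ifs with hg
    · refine Finset.prod_eq_one fun j _ => ?_
      rw [if_pos (Set.mem_range.2 (hg.2 j)), sub_zero]
    · have hs : ¬ Function.Surjective g := fun h => hg (Finite.surjective_iff_bijective.1 h)
      simp only [Function.Surjective, not_forall] at hs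
      obtain ⟨j, hj⟩ := hs
      refine Finset.prod_eq_zero (Finset.mem_univ j) ?_
      rw [if_neg (by simpa using hj), sub_self]
  simp_rw [h1, Finset.mul_sum]
  rw [Finset.sum_comm]
  simp_rw [← mul_assoc, ← Finset.sum_mul, h2, ite_mul, one_mul, zero_mul]
  rw [← Finset.sum_filter]
  have h3 : ∀ g ∈ Finset.univ.filter (fun g : Fin n → Fin n => Function.Bijective g),
      ∏ i, a (g i) = ∏ i, a i := by
    intro g hg
    exact Function.Bijective.prod_comp (by simpa using hg) a
  rw [Finset.sum_congr rfl h3, Finset.sum_const, nsmul_eq_mul]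
  congr 2
  have h4 : Fintype.card (Equiv.Perm (Fin n)) = n.factorial := by
    rw [Fintype.card_perm, Fintype.card_fin]
  rw [← h4, ← Fintype.card_subtype]
  exact Fintype.card_congr (Equiv.ofBijective
    (fun σ : Equiv.Perm (Fin n) => (⟨σ, σ.bijective⟩ : {g : Fin n → Fin n // Function.Bijective g}))
    ⟨fun σ τ h => Equiv.ext fun i => congrFun (congrArg Subtype.val h) i,
     fun g => ⟨Equiv.ofBijective g.1 g.2, by ext; simp⟩⟩)

variable {𝕜 : Type*} [RCLike 𝕜] {n : ℕ}
variable {M : Type*} [NormedAddCommGroup M] [NormedSpace 𝕜 M]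

/-- Products of linear forms from a family closed under addition are combinations of powers. -/
theorem prod_mem_span {X V : Type*} [AddCommGroup V] [Module 𝕜 V] (ev : V →ₗ[𝕜] (X → 𝕜))
    (v : Fin n → V) :
    (fun x => ∏ i, ev (v i) x) ∈ Submodule.span 𝕜 (Set.range fun w : V => fun x => ev w x ^ n) := by
  have h : (fun x => ∏ i, ev (v i) x) = ∑ t : Finset (Fin n),
      ((n.factorial : 𝕜)⁻¹ * (-1 : 𝕜) ^ t.card) • fun x => ev (∑ j ∈ tᶜ, v j) x ^ n := by
    ext x
    have := factorial_mul_prod_eq n fun i => ev (v i) x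
    have hn : (n.factorial : 𝕜) ≠ 0 := by exact_mod_cast n.factorial_ne_zero
    rw [eq_comm, ← inv_mul_eq_iff_eq_mul₀ hn] at this
    rw [← this, Finset.mul_sum, Finset.sum_apply]
    refine Finset.sum_congr rfl fun t _ => ?_
    simp [mul_assoc, Finset.sum_apply]
  rw [h]
  exact Submodule.sum_mem _ fun t _ => Submodule.smul_mem _ _ (Submodule.subset_span ⟨_, rfl⟩)

theorem exists_sum_powForm [FiniteDimensional 𝕜 M] (q : HomPoly 𝕜 n M) :
    ∃ c : StrongDual 𝕜 M →₀ 𝕜, ∀ x, (q : M → 𝕜) x = c.sum fun φ a => a * φ x ^ n := by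
  obtain ⟨f, hf⟩ := q.2
  let b := Module.finBasis 𝕜 M
  let ev : StrongDual 𝕜 M →ₗ[𝕜] (M → 𝕜) :=
    { toFun := fun φ x => φ x, map_add' := fun _ _ => rfl, map_smul' := fun _ _ => rfl }
  have key : (q : M → 𝕜) ∈
      Submodule.span 𝕜 (Set.range fun w : StrongDual 𝕜 M => fun x => ev w x ^ n) := by
    have h : (q : M → 𝕜) = ∑ r : Fin n → Fin (Module.finrank 𝕜 M),
        f (fun j => b (r j)) •
          fun x => ∏ j, ev (LinearMap.toContinuousLinearMap (b.coord (r j))) x := by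
      ext x
      rw [hf]
      conv_lhs => rw [← b.sum_repr x]
      rw [f.map_sum]
      simp [ContinuousMultilinearMap.map_smul_univ, Finset.sum_apply, ev, mul_comm]
    rw [h]
    exact Submodule.sum_mem _ fun r _ => Submodule.smul_mem _ _ (prod_mem_span ev _)
  obtain ⟨c, hc⟩ := (Finsupp.mem_span_range_iff_exists_finsupp).1 key
  refine ⟨c, fun x => ?_⟩
  rw [← hc]
  simp [Finsupp.sum, Finset.sum_apply, ev]

theorem exists_sum_powPoint [FiniteDimensional 𝕜 M] (p : HomPoly 𝕜 n (StrongDual 𝕜 M)) :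
    ∃ c : M →₀ 𝕜, ∀ φ, (p : StrongDual 𝕜 M → 𝕜) φ = c.sum fun x a => a * φ x ^ n := by
  obtain ⟨f, hf⟩ := p.2
  let b := Module.finBasis 𝕜 M
  let ev : M →ₗ[𝕜] (StrongDual 𝕜 M → 𝕜) :=
    { toFun := fun x φ => φ x
      map_add' := fun _ _ => by ext; simp
      map_smul' := fun _ _ => by ext; simp }
  have key : (p : StrongDual 𝕜 M → 𝕜) ∈
      Submodule.span 𝕜 (Set.range fun w : M => fun φ => ev w φ ^ n) := by
    have h : (p : StrongDual 𝕜 M → 𝕜) = ∑ r : Fin n → Fin (Module.finrank 𝕜 M),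
        f (fun j => LinearMap.toContinuousLinearMap (b.coord (r j))) •
          fun φ => ∏ j, ev (b (r j)) φ := by
      ext φ
      have hφ : φ = ∑ i, φ (b i) • LinearMap.toContinuousLinearMap (b.coord i) := by
        ext x
        conv_lhs => rw [← b.sum_repr x, map_sum]
        simp [mul_comm]
      rw [hf]
      conv_lhs => rw [hφ]
      rw [f.map_sum]
      simp [ContinuousMultilinearMap.map_smul_univ, Finset.sum_apply, ev, mul_comm]
    rw [h]
    exact Submodule.sum_mem _ fun r _ => Submodule.smul_mem _ _ (prod_mem_span ev _)
  obtain ⟨c, hc⟩ := (Finsupp.mem_span_range_iff_exists_finsupp).1 key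
  refine ⟨c, fun x => ?_⟩
  rw [← hc]
  simp [Finsupp.sum, Finset.sum_apply, ev]

/-- If `∑ a * φ(x) ^ n = ∑ b * φ(y) ^ n` for all `φ`, then `∑ a * q(x) = ∑ b * q(y)` for every
`n`-homogeneous polynomial `q`. -/
theorem sum_eval_congr [FiniteDimensional 𝕜 M] (q : HomPoly 𝕜 n M) (c d : M →₀ 𝕜)
    (h : ∀ φ : StrongDual 𝕜 M,
      (c.sum fun x a => a * φ x ^ n) = d.sum fun x a => a * φ x ^ n) :
    (c.sum fun x a => a * (q : M → 𝕜) x) = d.sum fun x a => a * (q : M → 𝕜) x := by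
  obtain ⟨e, he⟩ := exists_sum_powForm q
  have swap : ∀ c : M →₀ 𝕜, (c.sum fun x a => a * (q : M → 𝕜) x) =
      e.sum fun φ b => b * c.sum fun x a => a * φ x ^ n := by
    intro c
    simp only [he, Finsupp.sum, Finset.mul_sum]
    rw [Finset.sum_comm]
    exact Finset.sum_congr rfl fun _ _ => Finset.sum_congr rfl fun _ _ => by ring
  rw [swap, swap]
  simp_rw [h]

/-- The value of the trace duality: if `p = ∑ a * (φ ↦ φ(x) ^ n)`, then `⟨q, p⟩ = ∑ a * q(x)`
(see `traceVal_eq` for the independence of the representation). -/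
noncomputable def traceVal [FiniteDimensional 𝕜 M] (q : HomPoly 𝕜 n M)
    (p : HomPoly 𝕜 n (StrongDual 𝕜 M)) : 𝕜 :=
  (exists_sum_powPoint p).choose.sum fun x a => a * (q : M → 𝕜) x

theorem traceVal_eq [FiniteDimensional 𝕜 M] (q : HomPoly 𝕜 n M)
    (p : HomPoly 𝕜 n (StrongDual 𝕜 M)) (c : M →₀ 𝕜)
    (hc : ∀ φ, (p : StrongDual 𝕜 M → 𝕜) φ = c.sum fun x a => a * φ x ^ n) :
    traceVal q p = c.sum fun x a => a * (q : M → 𝕜) x :=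
  sum_eval_congr q _ _ fun φ => by rw [← hc, ← (exists_sum_powPoint p).choose_spec]

theorem traceVal_add_left [FiniteDimensional 𝕜 M] (q r : HomPoly 𝕜 n M)
    (p : HomPoly 𝕜 n (StrongDual 𝕜 M)) : traceVal (q + r) p = traceVal q p + traceVal r p := by
  obtain ⟨c, hc⟩ := exists_sum_powPoint p
  rw [traceVal_eq _ p c hc, traceVal_eq _ p c hc, traceVal_eq _ p c hc, ← Finsupp.sum_add]
  exact Finsupp.sum_congr fun x _ => mul_add _ _ _

theorem traceVal_smul_left [FiniteDimensional 𝕜 M] (t : 𝕜) (q : HomPoly 𝕜 n M)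
    (p : HomPoly 𝕜 n (StrongDual 𝕜 M)) : traceVal (t • q) p = t • traceVal q p := by
  obtain ⟨c, hc⟩ := exists_sum_powPoint p
  rw [traceVal_eq _ p c hc, traceVal_eq _ p c hc, Finsupp.smul_sum]
  exact Finsupp.sum_congr fun x _ => mul_left_comm _ _ _

theorem traceVal_add_right [FiniteDimensional 𝕜 M] (q : HomPoly 𝕜 n M)
    (p r : HomPoly 𝕜 n (StrongDual 𝕜 M)) : traceVal q (p + r) = traceVal q p + traceVal q r := by
  classical
  obtain ⟨c, hc⟩ := exists_sum_powPoint p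
  obtain ⟨d, hd⟩ := exists_sum_powPoint r
  rw [traceVal_eq q p c hc, traceVal_eq q r d hd, traceVal_eq q (p + r) (c + d),
    Finsupp.sum_add_index' (fun _ => zero_mul _) (fun _ _ _ => add_mul _ _ _)]
  intro φ
  rw [Finsupp.sum_add_index' (fun _ => zero_mul _) (fun _ _ _ => add_mul _ _ _), ← hc, ← hd]
  rfl

theorem traceVal_smul_right [FiniteDimensional 𝕜 M] (t : 𝕜) (q : HomPoly 𝕜 n M)
    (p : HomPoly 𝕜 n (StrongDual 𝕜 M)) : traceVal q (t • p) = t • traceVal q p := by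
  obtain ⟨c, hc⟩ := exists_sum_powPoint p
  rw [traceVal_eq q p c hc, traceVal_eq q (t • p) (t • c),
    Finsupp.sum_smul_index' (fun _ => zero_mul _), Finsupp.smul_sum]
  · exact Finsupp.sum_congr fun x _ => mul_assoc _ _ _
  intro φ
  rw [Finsupp.sum_smul_index' (fun _ => zero_mul _)]
  have : ((t • p : HomPoly 𝕜 n (StrongDual 𝕜 M)) : StrongDual 𝕜 M → 𝕜) φ
    = t • (p : StrongDual 𝕜 M → 𝕜) φ := rfl
  rw [this, hc, Finsupp.smul_sum]
  exact Finsupp.sum_congr fun x _ => (mul_assoc _ _ _).symm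

/-- The trace duality `⟨q, p⟩` between `n`-homogeneous polynomials on the finite dimensional space
`M` and on its dual `M'`: the bilinear form with `⟨φ ^ n, x ^ n⟩ = φ(x) ^ n`. -/
noncomputable def tracePairing (𝕜 : Type*) [RCLike 𝕜] (n : ℕ) (M : Type*) [NormedAddCommGroup M]
    [NormedSpace 𝕜 M] [FiniteDimensional 𝕜 M] :
    HomPoly 𝕜 n M →ₗ[𝕜] HomPoly 𝕜 n (StrongDual 𝕜 M) →ₗ[𝕜] 𝕜 :=
  LinearMap.mk₂ 𝕜 traceVal traceVal_add_left traceVal_smul_left traceVal_add_right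
    traceVal_smul_right

theorem tracePairing_powPoint [FiniteDimensional 𝕜 M] (q : HomPoly 𝕜 n M) (x : M) :
    tracePairing 𝕜 n M q (powPoint n x) = (q : M → 𝕜) x := by
  refine (traceVal_eq q _ (Finsupp.single x 1) fun φ => ?_).trans ?_
  · simp [powPoint, powForm]
  · simp

theorem tracePairing_powForm_powPoint [FiniteDimensional 𝕜 M] (φ : StrongDual 𝕜 M) (x : M) :
    tracePairing 𝕜 n M (powForm n φ) (powPoint n x) = φ x ^ n := by
  rw [tracePairing_powPoint]
  rfl

end TraceDuality

/-! ### Ideals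

An ideal of polynomials (of operators), given by a class together with a norm on each of its
components, is encoded by one extended norm with values in `[0, ∞]`: the class consists of the
polynomials (operators) of finite extended norm. All spaces are Banach spaces over `𝕜 = ℝ` or `ℂ`.
-/

instance completeSpace_of_finiteDimensional_submodule {𝕜 : Type*} [RCLike 𝕜] {E : Type*}
    [NormedAddCommGroup E] [NormedSpace 𝕜 E] (M : Submodule 𝕜 E) [FiniteDimensional 𝕜 M] :
    CompleteSpace M :=
  FiniteDimensional.complete 𝕜 M

/-- An assignment of an extended norm to the `n`-homogeneous polynomials on all Banach spaces. -/
abbrev PolyGauge (𝕜 : Type u) [RCLike 𝕜] (n : ℕ) : Type (u + 1) :=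
  ∀ (E : Type u) [NormedAddCommGroup E] [NormedSpace 𝕜 E] [CompleteSpace E],
    HomPoly 𝕜 n E → ℝ≥0∞

/-- An assignment of an extended norm to the bounded operators between all Banach spaces. -/
abbrev OpGauge (𝕜 : Type u) [RCLike 𝕜] : Type (u + 1) :=
  ∀ (E F : Type u) [NormedAddCommGroup E] [NormedSpace 𝕜 E] [CompleteSpace E]
    [NormedAddCommGroup F] [NormedSpace 𝕜 F] [CompleteSpace F], (E →L[𝕜] F) → ℝ≥0∞

/-- `N` is an extended norm on `V` and the space `{v | N v < ∞}`, normed by `N`, is complete. -/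
structure IsCompleteExtNorm (𝕜 : Type*) [RCLike 𝕜] {V : Type*} [AddCommGroup V] [Module 𝕜 V]
    (N : V → ℝ≥0∞) : Prop where
  add_le : ∀ v w, N (v + w) ≤ N v + N w
  smul : ∀ (c : 𝕜) (v : V), N (c • v) = ‖c‖ₑ * N v
  eq_zero : ∀ v, N v = 0 → v = 0
  complete : ∀ v : ℕ → V, (∀ k, N (v k) < ∞) →
    (∀ ε : ℝ≥0∞, 0 < ε → ∃ k₀, ∀ k ≥ k₀, ∀ l ≥ k₀, N (v k - v l) ≤ ε) →
    ∃ w, N w < ∞ ∧ Filter.Tendsto (fun k => N (v k - w)) Filter.atTop (𝓝 0)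

section PolynomialIdeals

variable {𝕜 : Type u} [RCLike 𝕜] {n : ℕ}

/-- `Q` is a Banach ideal of continuous scalar valued `n`-homogeneous polynomials. -/
structure IsBanachPolyIdeal (Q : PolyGauge.{u} 𝕜 n) : Prop where
  extNorm : ∀ (E : Type u) [NormedAddCommGroup E] [NormedSpace 𝕜 E] [CompleteSpace E],
    IsCompleteExtNorm 𝕜 (Q E)
  comp_le : ∀ (E F : Type u) [NormedAddCommGroup E] [NormedSpace 𝕜 E] [CompleteSpace E]
    [NormedAddCommGroup F] [NormedSpace 𝕜 F] [CompleteSpace F]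
    (T : E →L[𝕜] F) (p : HomPoly 𝕜 n F), Q F p < ∞ → Q E (polyComp p T) ≤ Q F p * ‖T‖ₑ ^ n
  pow_id : Q 𝕜 (powForm n (ContinuousLinearMap.id 𝕜 𝕜)) = 1

/-- `p` belongs to the class `Q`. -/
def PolyGauge.Mem (Q : PolyGauge.{u} 𝕜 n) (E : Type u) [NormedAddCommGroup E] [NormedSpace 𝕜 E]
    [CompleteSpace E] (p : HomPoly 𝕜 n E) : Prop :=
  Q E p < ∞

/-- The two classes coincide and so do their norms. -/
def PolyGauge.IsometricallyEq (Q R : PolyGauge.{u} 𝕜 n) : Prop :=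
  ∀ (E : Type u) [NormedAddCommGroup E] [NormedSpace 𝕜 E] [CompleteSpace E] (p : HomPoly 𝕜 n E),
    (Q.Mem E p ↔ R.Mem E p) ∧ (Q.Mem E p → Q E p = R E p)

/-- The adjoint `Q^*`: the norm of `q` on `E` is the supremum of `|⟨q|_M, p⟩|` over the finite
dimensional subspaces `M` of `E` and the `p ∈ Q(M')` with `‖p‖ ≤ 1`. -/
noncomputable def PolyGauge.adjoint (Q : PolyGauge.{u} 𝕜 n) : PolyGauge.{u} 𝕜 n :=
  fun E _ _ _ q =>
    ⨆ (M : Submodule 𝕜 E) (_ : FiniteDimensional 𝕜 M) (p : HomPoly 𝕜 n (StrongDual 𝕜 M))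
      (_ : Q (StrongDual 𝕜 M) p ≤ 1), ‖tracePairing 𝕜 n M (polyComp q M.subtypeL) p‖ₑ

/-- The composition `Q ∘ A`: the norm of `p` is the infimum of `‖q‖_Q * ‖T‖_A ^ n` over all
factorizations `p = q ∘ T` with `T ∈ A(E, F)` and `q ∈ Q(F)` (and `∞` if there are none). -/
noncomputable def PolyGauge.compIdeal (Q : PolyGauge.{u} 𝕜 n) (A : OpGauge.{u} 𝕜) :
    PolyGauge.{u} 𝕜 n :=
  fun E _ _ _ p =>
    sInf {c : ℝ≥0∞ | ∃ (F : Type u) (_ : NormedAddCommGroup F) (_ : NormedSpace 𝕜 F)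
      (_ : CompleteSpace F) (T : E →L[𝕜] F) (q : HomPoly 𝕜 n F),
      A E F T < ∞ ∧ Q F q < ∞ ∧ p = polyComp q T ∧ c = Q F q * A E F T ^ n}

/-- The quotient `Q ∘ A⁻¹`: the norm of `p` on `E` is the supremum of `‖p ∘ T‖_Q` over all Banach
spaces `G` and all `T ∈ A(G, E)` with `‖T‖_A ≤ 1`. -/
noncomputable def PolyGauge.compInvIdeal (Q : PolyGauge.{u} 𝕜 n) (A : OpGauge.{u} 𝕜) :
    PolyGauge.{u} 𝕜 n :=
  fun E _ _ _ p =>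
    sSup {c : ℝ≥0∞ | ∃ (G : Type u) (_ : NormedAddCommGroup G) (_ : NormedSpace 𝕜 G)
      (_ : CompleteSpace G) (T : G →L[𝕜] E), A G E T ≤ 1 ∧ c = Q G (polyComp p T)}

end PolynomialIdeals

section OperatorIdeals

variable {𝕜 : Type u} [RCLike 𝕜]

/-- `A` is a Banach operator ideal. -/
structure IsBanachOpIdeal (A : OpGauge.{u} 𝕜) : Prop where
  extNorm : ∀ (E F : Type u) [NormedAddCommGroup E] [NormedSpace 𝕜 E] [CompleteSpace E]
    [NormedAddCommGroup F] [NormedSpace 𝕜 F] [CompleteSpace F], IsCompleteExtNorm 𝕜 (A E F)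
  comp_le : ∀ (E₀ E F F₀ : Type u) [NormedAddCommGroup E₀] [NormedSpace 𝕜 E₀] [CompleteSpace E₀]
    [NormedAddCommGroup E] [NormedSpace 𝕜 E] [CompleteSpace E]
    [NormedAddCommGroup F] [NormedSpace 𝕜 F] [CompleteSpace F]
    [NormedAddCommGroup F₀] [NormedSpace 𝕜 F₀] [CompleteSpace F₀]
    (S : E₀ →L[𝕜] E) (T : E →L[𝕜] F) (R : F →L[𝕜] F₀), A E F T < ∞ →
    A E₀ F₀ (R.comp (T.comp S)) ≤ ‖R‖ₑ * A E F T * ‖S‖ₑ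
  id_scalar : A 𝕜 𝕜 (ContinuousLinearMap.id 𝕜 𝕜) = 1

/-- The (Banach space) adjoint `T' : F' → E'` of `T : E → F`. -/
noncomputable def dualOp {E F : Type*} [NormedAddCommGroup E] [NormedSpace 𝕜 E]
    [NormedAddCommGroup F] [NormedSpace 𝕜 F] (T : E →L[𝕜] F) :
    StrongDual 𝕜 F →L[𝕜] StrongDual 𝕜 E :=
  ContinuousLinearMap.precomp 𝕜 T

/-- The dual ideal: `T ∈ A^dual(E, F)` iff `T' ∈ A(F', E')`, with the norm of `T'`. -/
noncomputable def OpGauge.dual (A : OpGauge.{u} 𝕜) : OpGauge.{u} 𝕜 :=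
  fun E F _ _ _ _ _ _ T => A (StrongDual 𝕜 F) (StrongDual 𝕜 E) (dualOp T)

/-- The maximal hull: the norm of `T : E → F` is the supremum of the norms of `Q_L ∘ T ∘ I_M`, with
`I_M` the inclusion of a finite dimensional subspace `M` of `E` and `Q_L` the quotient map of `F`
by a closed finite codimensional subspace `L`. -/
noncomputable def OpGauge.maxHull (A : OpGauge.{u} 𝕜) : OpGauge.{u} 𝕜 :=
  fun E F _ _ _ _ _ _ T =>
    ⨆ (M : Submodule 𝕜 E) (_ : FiniteDimensional 𝕜 M) (L : Submodule 𝕜 F)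
      (_ : IsClosed (L : Set F)) (_ : FiniteDimensional 𝕜 (F ⧸ L)),
      A M (F ⧸ L) (L.mkQL.comp (T.comp M.subtypeL))

/-- `A` is maximal: it coincides isometrically with its maximal hull. -/
def OpGauge.IsMaximal (A : OpGauge.{u} 𝕜) : Prop :=
  ∀ (E F : Type u) [NormedAddCommGroup E] [NormedSpace 𝕜 E] [CompleteSpace E]
    [NormedAddCommGroup F] [NormedSpace 𝕜 F] [CompleteSpace F] (T : E →L[𝕜] F),
    A E F T = A.maxHull E F T

/-- `A` is right-accessible: every operator `T : M → F` with `M` finite dimensional factors, for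
each `ε > 0`, as `T = I_N ∘ S` through a finite dimensional subspace `N` of `F` with
`‖S‖_A ≤ (1 + ε) ‖T‖_A`. -/
def OpGauge.IsRightAccessible (A : OpGauge.{u} 𝕜) : Prop :=
  ∀ (M F : Type u) [NormedAddCommGroup M] [NormedSpace 𝕜 M] [CompleteSpace M]
    [FiniteDimensional 𝕜 M] [NormedAddCommGroup F] [NormedSpace 𝕜 F] [CompleteSpace F]
    (T : M →L[𝕜] F) (ε : ℝ≥0), 0 < ε →
    ∃ (N : Submodule 𝕜 F) (_ : FiniteDimensional 𝕜 N) (S : M →L[𝕜] N),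
      T = N.subtypeL.comp S ∧ A M N S ≤ (1 + ε) * A M F T

/-- `A` is left-accessible: every operator `T : E → N` with `N` finite dimensional factors, for
each `ε > 0`, as `T = S ∘ Q_L` through the quotient by a closed finite codimensional subspace `L`
of `E` with `‖S‖_A ≤ (1 + ε) ‖T‖_A`. -/
def OpGauge.IsLeftAccessible (A : OpGauge.{u} 𝕜) : Prop :=
  ∀ (E N : Type u) [NormedAddCommGroup E] [NormedSpace 𝕜 E] [CompleteSpace E]
    [NormedAddCommGroup N] [NormedSpace 𝕜 N] [CompleteSpace N] [FiniteDimensional 𝕜 N]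
    (T : E →L[𝕜] N) (ε : ℝ≥0), 0 < ε →
    ∃ (L : Submodule 𝕜 E) (_ : IsClosed (L : Set E)) (_ : FiniteDimensional 𝕜 (E ⧸ L))
      (S : (E ⧸ L) →L[𝕜] N), T = S.comp L.mkQL ∧ A (E ⧸ L) N S ≤ (1 + ε) * A E N T

/-- `A` is accessible: it is right- and left-accessible. -/
def OpGauge.IsAccessible (A : OpGauge.{u} 𝕜) : Prop :=
  A.IsRightAccessible ∧ A.IsLeftAccessible

end OperatorIdeals

end BanachIdeals

/-!
The proof compares the two suprema term by term.

A polynomial `r` on `M'`, with `M` a finite dimensional subspace of `E`, that tests `p` in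
`(Q ∘ A)^*` has the form `r = q ∘ T` with `T : M' → F`. If `A` is right-accessible, then `T`
factors, up to `1 + ε` in norm, as `S : M' → N` followed by the inclusion of a finite dimensional
subspace `N` of `F`. Now `S' : N' → M'' = M ⊂ E` is an admissible operator for `Q^* ∘ (A^dual)⁻¹`,
and `⟨p|_M, s ∘ S⟩ = ⟨p ∘ S', s⟩` for the restriction `s` of `q` to `N`; see
`tracePairing_polyComp` and `enorm_tracePairing_comp_le_compInvIdeal`. This gives one inequality,
`adjoint_compIdeal_le_compInvIdeal`.

Conversely, let `T : G → E` satisfy `‖T'‖_A ≤ 1` and let `s` on `M'`, for `M` a finite dimensional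
subspace of `G`, test `p ∘ T`. If `A^dual` is right-accessible, then the restriction of `T` to `M`
factors through some `S : M → N` with `N` a finite dimensional subspace of `E` and
`‖S'‖_A ≤ 1 + ε`. The polynomial `s ∘ S'` on `N'` lies in `Q ∘ A` and tests `p` itself, with the
same value of the trace duality; this is `compInvIdeal_le_adjoint_compIdeal`.

It remains to see that `A^dual` is right-accessible when `A` is left-accessible
(`IsBanachOpIdeal.isRightAccessible_dual`). Left-accessibility factors the adjoint of `T : M → F`
through a finite dimensional quotient `F' / L`, whose dual is a subspace of `F''` but in general not
of `F`. The principle of local reflexivity, `exists_operator_of_bidual`, maps it into `F` with norm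
at most `1 + ε` and fixes the image of `T`.
-/

namespace BanachIdeals

-- the norm on operators into a bidual is found only with this depth
set_option maxSynthPendingDepth 3

/-! ### Local reflexivity -/

section LocalReflexivity

variable {𝕜 : Type*} [RCLike 𝕜]
variable {Z E : Type*} [NormedAddCommGroup Z] [NormedSpace 𝕜 Z]
  [NormedAddCommGroup E] [NormedSpace 𝕜 E]

/-- The easy half of the isometry between the dual of a finite sup-normed power of `E` and the
`ℓ¹`-sum of copies of the dual of `E`. -/
theorem sum_norm_comp_single_le {ι : Type*} [Fintype ι] [DecidableEq ι]
    (Φ : StrongDual 𝕜 (ι → E)) :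
    ∑ k, ‖Φ.comp (ContinuousLinearMap.single 𝕜 (fun _ => E) k)‖ ≤ ‖Φ‖ := by
  set η := fun k => Φ.comp (ContinuousLinearMap.single 𝕜 (fun _ => E) k)
  have key : ∀ δ : ℝ, 0 < δ → ∑ k, (‖η k‖ - δ) ≤ ‖Φ‖ := by
    intro δ hδ
    choose x hx1 hx2 using fun k =>
      (η k).exists_lt_apply_of_lt_opNorm (r := ‖η k‖ - δ) (by linarith)
    choose c hc1 hc2 using fun k => RCLike.exists_norm_eq_mul_self (η k (x k))
    have hsum : Φ (fun k => c k • x k) = ((∑ k, ‖η k (x k)‖ : ℝ) : 𝕜) := by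
      have e : (fun k => c k • x k) =
          ∑ k, ContinuousLinearMap.single 𝕜 (fun _ => E) k (c k • x k) := by
        ext j
        simp [Finset.sum_apply, Pi.single_apply]
      rw [e, map_sum, RCLike.ofReal_sum]
      refine Finset.sum_congr rfl fun k _ => ?_
      change η k (c k • x k) = _
      rw [map_smul, smul_eq_mul, hc2 k]
    calc ∑ k, (‖η k‖ - δ) ≤ ∑ k, ‖η k (x k)‖ := Finset.sum_le_sum fun k _ => (hx2 k).le
      _ = ‖Φ (fun k => c k • x k)‖ := by
          rw [hsum, RCLike.norm_ofReal, abs_of_nonneg (Finset.sum_nonneg fun _ _ => norm_nonneg _)]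
      _ ≤ ‖Φ‖ * ‖fun k => c k • x k‖ := Φ.le_opNorm _
      _ ≤ ‖Φ‖ * 1 := by
          gcongr
          refine (pi_norm_le_iff_of_nonneg zero_le_one).2 fun k => ?_
          rw [norm_smul, hc1, one_mul]
          exact (hx1 k).le
      _ = ‖Φ‖ := mul_one _
  have hlim : Filter.Tendsto (fun δ : ℝ => ∑ k, (‖η k‖ - δ)) (𝓝[>] 0) (𝓝 (∑ k, ‖η k‖)) := by
    have : Continuous fun δ : ℝ => ∑ k, (‖η k‖ - δ) := by fun_prop
    simpa using (this.tendsto 0).mono_left nhdsWithin_le_nhds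
  exact le_of_tendsto hlim (Filter.eventually_of_mem self_mem_nhdsWithin key)

/-- On a finite dimensional space the operator norm is determined, up to a factor close to one, by
finitely many vectors of the unit ball. -/
theorem exists_finite_norming_set [FiniteDimensional 𝕜 Z] {δ : ℝ} (hδ : 0 < δ) :
    ∃ t : Set Z, t.Finite ∧ (∀ z ∈ t, ‖z‖ ≤ 1) ∧
      ∀ (R : Z →L[𝕜] E) (c : ℝ), 0 ≤ c → (∀ z ∈ t, ‖R z‖ ≤ c) → (1 - δ) * ‖R‖ ≤ c := by
  have : ProperSpace Z := FiniteDimensional.proper 𝕜 Z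
  obtain ⟨t, hts, htf, hcov⟩ := Metric.finite_approx_of_totallyBounded
    (isCompact_closedBall (0 : Z) 1).totallyBounded δ hδ
  refine ⟨t, htf, fun z hz => by simpa using hts hz, fun R c hc hR => ?_⟩
  have : ‖R‖ ≤ c + δ * ‖R‖ := by
    refine R.opNorm_le_of_unit_norm (𝕜 := 𝕜) (by positivity) fun z hz => ?_
    obtain ⟨y, hy, hyz⟩ := Set.mem_iUnion₂.1 (hcov (show z ∈ Metric.closedBall 0 1 by simp [hz]))
    have h1 : ‖z - y‖ ≤ δ := by
      rw [← dist_eq_norm]; exact (Metric.mem_ball.1 hyz).le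
    calc ‖R z‖ = ‖R y + R (z - y)‖ := by rw [← map_add]; simp
      _ ≤ ‖R y‖ + ‖R (z - y)‖ := norm_add_le _ _
      _ ≤ c + ‖R‖ * δ := add_le_add (hR y hy) ((R.le_opNorm _).trans (by gcongr))
      _ = c + δ * ‖R‖ := by ring
  linarith

/-- A functional on `Z →L E`, with `Z` finite dimensional, is a sum of functionals
`R ↦ η (R z)` whose total norm is nearly optimal: extend it by Hahn–Banach from the image of
`Z →L E` in a finite power of `E` under evaluation at a norming set. -/
theorem exists_sum_evaluations [FiniteDimensional 𝕜 Z] (φ : StrongDual 𝕜 (Z →L[𝕜] E))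
    {δ : ℝ} (hδ : 0 < δ) (hδ1 : δ < 1) :
    ∃ (t : Set Z) (_ : Fintype t) (η : t → StrongDual 𝕜 E), (∀ z ∈ t, ‖z‖ ≤ 1) ∧
      (∀ R, φ R = ∑ z : t, η z (R z)) ∧ (1 - δ) * ∑ z, ‖η z‖ ≤ ‖φ‖ := by
  classical
  obtain ⟨t, htf, ht1, htR⟩ := exists_finite_norming_set (𝕜 := 𝕜) (Z := Z) (E := E) hδ
  have hδ' : 0 < 1 - δ := by linarith
  let _ : Fintype t := htf.fintype
  let ev : (Z →L[𝕜] E) →ₗ[𝕜] (t → E) :=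
    { toFun := fun R k => R k
      map_add' := fun _ _ => rfl
      map_smul' := fun _ _ => rfl }
  have hev : ∀ R, (1 - δ) * ‖R‖ ≤ ‖ev R‖ := fun R =>
    htR R _ (norm_nonneg _) fun z hz => norm_le_pi_norm (ev R) ⟨z, hz⟩
  have hinj : Function.Injective ev := by
    refine (injective_iff_map_eq_zero ev).2 fun R hR => ?_
    have := hev R
    rw [hR, norm_zero] at this
    exact norm_le_zero_iff.1 (nonpos_of_mul_nonpos_right this hδ')
  let e := LinearEquiv.ofInjective ev hinj
  let f : StrongDual 𝕜 (LinearMap.range ev) :=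
    (φ.toLinearMap ∘ₗ e.symm.toLinearMap).mkContinuous (‖φ‖ / (1 - δ)) fun y => by
      obtain ⟨R, rfl⟩ := e.surjective y
      have h1 : ‖e R‖ = ‖ev R‖ := rfl
      have h2 := hev R
      calc ‖(φ.toLinearMap ∘ₗ e.symm.toLinearMap) (e R)‖ = ‖φ R‖ := by simp
        _ ≤ ‖φ‖ * ‖R‖ := φ.le_opNorm R
        _ ≤ ‖φ‖ * (‖ev R‖ / (1 - δ)) := by
            gcongr; rw [le_div_iff₀ hδ']; linarith
        _ = ‖φ‖ / (1 - δ) * ‖e R‖ := by rw [h1]; ring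
  obtain ⟨Φ, hΦ, hΦn⟩ := exists_extension_norm_eq _ f
  refine ⟨t, inferInstance,
    fun k => Φ.comp (ContinuousLinearMap.single 𝕜 (fun _ => E) k), ht1, fun R => ?_, ?_⟩
  · have h1 : φ R = Φ (ev R) := by
      have h3 : f (e R) = φ R := by simp [f]
      rw [← h3, ← hΦ]
      rfl
    have h2 : ev R = ∑ k, ContinuousLinearMap.single 𝕜 (fun _ : t => E) k (R k) := by
      ext j
      simp [Finset.sum_apply, Pi.single_apply, ev]
    rw [h1, h2, map_sum]
    rfl
  · have h1 := sum_norm_comp_single_le Φ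
    have h2 : ‖f‖ ≤ ‖φ‖ / (1 - δ) := LinearMap.mkContinuous_norm_le _ (by positivity) _
    rw [← hΦn, le_div_iff₀ hδ'] at h2
    nlinarith

/-- If the tensor `∑ z k ⊗ η k` vanishes, tested on the first factor, then so does every bilinear
form on it. -/
theorem sum_apply_eq_zero_of_forall_dual [FiniteDimensional 𝕜 Z] {ι V : Type*} [Fintype ι]
    [AddCommGroup V] [Module 𝕜 V] (J : Z →ₗ[𝕜] V →ₗ[𝕜] 𝕜) (z : ι → Z) (η : ι → V)
    (h : ∀ ζ : StrongDual 𝕜 Z, ∑ k, ζ (z k) • η k = 0) : ∑ k, J (z k) (η k) = 0 := by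
  let b := Module.finBasis 𝕜 Z
  have h1 : ∀ k, J (z k) (η k) = ∑ i, J (b i) (b.repr (z k) i • η k) := by
    intro k
    conv_lhs => rw [← b.sum_repr (z k)]
    simp only [map_sum, map_smul, LinearMap.sum_apply, LinearMap.smul_apply]
  simp_rw [h1]
  rw [Finset.sum_comm]
  refine Finset.sum_eq_zero fun i _ => ?_
  have := h (LinearMap.toContinuousLinearMap (b.coord i))
  rw [← map_sum]
  simp only [LinearMap.coe_toContinuousLinearMap', Module.Basis.coord_apply] at this
  rw [this, map_zero]

/-- The **principle of local reflexivity**, in the form needed here: a contraction `J` from a finite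
dimensional space `Z` to the bidual of `E` can be replaced by an operator `R : Z →L E` of norm at
most `1 + ε` that agrees with `J` wherever a given `w : M →L Z` takes `J` into `E`.

By duality in the quotient of `Z →L E` by the operators vanishing on the range `W` of `w`, it is
enough to bound `φ R₀` for one operator `R₀` with the prescribed values on `W` and every functional
`φ` that vanishes on that subspace. Such a `φ` is a sum of functionals `R ↦ η (R z)`, which makes
sense for `J` in place of `R₀` and gives there the same value, of modulus at most `∑ ‖η‖`. -/
theorem exists_operator_of_bidual {M : Type*} [NormedAddCommGroup M] [NormedSpace 𝕜 M]
    [FiniteDimensional 𝕜 M] [FiniteDimensional 𝕜 Z]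
    (J : Z →L[𝕜] StrongDual 𝕜 (StrongDual 𝕜 E)) (hJ : ‖J‖ ≤ 1) (w : M →L[𝕜] Z) (x : M →L[𝕜] E)
    (h : ∀ m, J (w m) = NormedSpace.inclusionInDoubleDual 𝕜 E (x m)) {ε : ℝ} (hε : 0 < ε) :
    ∃ R : Z →L[𝕜] E, ‖R‖ ≤ 1 + ε ∧ R.comp w = x := by
  let W := LinearMap.range w.toLinearMap
  obtain ⟨g, hg⟩ := (w.toLinearMap.rangeRestrict).exists_rightInverse_of_surjective
    (LinearMap.range_rangeRestrict _)
  have hg' : ∀ y : W, w (g y) = y := fun y => congrArg Subtype.val (LinearMap.congr_fun hg y)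
  obtain ⟨P, hP⟩ := Submodule.ClosedComplemented.of_finiteDimensional (𝕜 := 𝕜) W
  -- the required values on `W`, extended to `Z` by means of a projection onto `W`
  let r : W →L[𝕜] E := x.comp (LinearMap.toContinuousLinearMap g)
  have hr : ∀ y : W, J y = NormedSpace.inclusionInDoubleDual 𝕜 E (r y) := fun y => by
    rw [← hg' y, h]; rfl
  let R₀ : Z →L[𝕜] E := r.comp P
  let K : Submodule 𝕜 (Z →L[𝕜] E) :=
    LinearMap.ker (ContinuousLinearMap.precomp E W.subtypeL :
      (Z →L[𝕜] E) →L[𝕜] (W →L[𝕜] E)).toLinearMap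
  have hK : ∀ R, R ∈ K ↔ ∀ y : W, R y = 0 := fun R => by
    rw [LinearMap.mem_ker]
    exact ContinuousLinearMap.ext_iff
  have hKc : IsClosed (K : Set (Z →L[𝕜] E)) :=
    ContinuousLinearMap.isClosed_ker (ContinuousLinearMap.precomp E W.subtypeL :
      (Z →L[𝕜] E) →L[𝕜] (W →L[𝕜] E))
  have hq : ‖K.mkQL R₀‖ ≤ 1 := by
    obtain ⟨ψ, hψn, hψ⟩ := exists_dual_vector'' 𝕜 (K.mkQL R₀)
    let φ : StrongDual 𝕜 (Z →L[𝕜] E) := ψ.comp K.mkQL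
    have hφn : ‖φ‖ ≤ 1 := by
      refine φ.opNorm_le_bound zero_le_one fun R => ?_
      calc ‖φ R‖ ≤ ‖ψ‖ * ‖K.mkQL R‖ := ψ.le_opNorm _
        _ ≤ 1 * ‖R‖ := by gcongr; exact Submodule.Quotient.norm_mk_le K R
    have hφK : ∀ R ∈ K, φ R = 0 := fun R hR => by
      have : K.mkQL R = 0 := (Submodule.Quotient.mk_eq_zero K).2 hR
      simp [φ, this]
    have hbd : ∀ δ : ℝ, 0 < δ → δ < 1 → (1 - δ) * ‖K.mkQL R₀‖ ≤ 1 := by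
      intro δ hδ hδ1
      obtain ⟨t, _, η, hz, hφ, hη⟩ := exists_sum_evaluations φ hδ hδ1
      -- `φ` vanishes on the rank one operators of `K`, which are the `(ζ - ζ ∘ P) ⊗ v`.
      have e1 : ∑ z : t, J (z - P z) (η z) = 0 := by
        refine sum_apply_eq_zero_of_forall_dual
          (ContinuousLinearMap.coeLM 𝕜 ∘ₗ J.toLinearMap) (fun z : t => (z : Z) - P z) η fun ζ => ?_
        ext v
        have h0 := hφK ((ζ - ζ.comp (W.subtypeL.comp P)).smulRight v)
          ((hK _).2 fun y => by simp [hP y])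
        rw [hφ] at h0
        simpa [Finset.sum_apply, sub_mul] using h0
      have e2 : φ R₀ = ∑ z : t, J z (η z) := by
        rw [hφ, ← sub_eq_zero, ← Finset.sum_sub_distrib, ← neg_eq_zero, ← Finset.sum_neg_distrib,
          ← e1]
        refine Finset.sum_congr rfl fun z _ => ?_
        rw [map_sub, hr]
        simp [R₀, NormedSpace.dual_def]
      have e3 : ‖K.mkQL R₀‖ ≤ ∑ z, ‖η z‖ := by
        have : ‖φ R₀‖ = ‖K.mkQL R₀‖ := by
          change ‖ψ (K.mkQL R₀)‖ = _
          rw [hψ]; simp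
        rw [← this, e2]
        refine (norm_sum_le _ _).trans (Finset.sum_le_sum fun z _ => ?_)
        calc ‖J z (η z)‖ ≤ ‖J z‖ * ‖η z‖ := (J z).le_opNorm _
          _ ≤ (1 * 1) * ‖η z‖ := by
              gcongr
              exact (J.le_opNorm _).trans (mul_le_mul hJ (hz z z.2) (norm_nonneg _) zero_le_one)
          _ = ‖η z‖ := by ring
      have hδ' : 0 ≤ 1 - δ := by linarith
      exact (mul_le_mul_of_nonneg_left e3 hδ').trans (hη.trans hφn)
    have hlim : Filter.Tendsto (fun δ : ℝ => (1 - δ) * ‖K.mkQL R₀‖) (𝓝[>] 0)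
        (𝓝 ‖K.mkQL R₀‖) := by
      have : Continuous fun δ : ℝ => (1 - δ) * ‖K.mkQL R₀‖ := by fun_prop
      simpa using (this.tendsto 0).mono_left nhdsWithin_le_nhds
    refine le_of_tendsto hlim ?_
    filter_upwards [Ioo_mem_nhdsGT (zero_lt_one' ℝ)] with δ hδ using hbd δ hδ.1 hδ.2
  obtain ⟨R, hR, hRn⟩ := Submodule.Quotient.norm_mk_lt (S := K) (K.mkQL R₀) hε
  refine ⟨R, by linarith, ?_⟩
  have hRK : R - R₀ ∈ K := (Submodule.Quotient.eq K).1 hR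
  ext m
  obtain ⟨y, hy⟩ : ∃ y : W, (y : Z) = w m := ⟨⟨w m, m, rfl⟩, rfl⟩
  have h2 : R (w m) = r y := by
    have h1 : R y = r (P y) := sub_eq_zero.1 ((hK _).1 hRK y)
    rw [← hy, h1, hP]
  apply (NormedSpace.inclusionInDoubleDualLi 𝕜 (E := E)).injective
  change NormedSpace.inclusionInDoubleDual 𝕜 E (R (w m)) =
    NormedSpace.inclusionInDoubleDual 𝕜 E (x m)
  rw [h2, ← hr, hy, h]

theorem finrank_strongDual [FiniteDimensional 𝕜 Z] :
    Module.finrank 𝕜 (StrongDual 𝕜 Z) = Module.finrank 𝕜 Z :=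
  (LinearMap.toContinuousLinearMap (𝕜 := 𝕜) (E := Z) (F' := 𝕜)).finrank_eq.symm.trans
    Subspace.dual_finrank_eq

/-- The canonical isometry of a finite dimensional space onto its bidual. -/
noncomputable def bidualEquiv (𝕜 : Type*) [RCLike 𝕜] (Z : Type*) [NormedAddCommGroup Z]
    [NormedSpace 𝕜 Z] [FiniteDimensional 𝕜 Z] : Z ≃ₗᵢ[𝕜] StrongDual 𝕜 (StrongDual 𝕜 Z) :=
  LinearIsometryEquiv.ofSurjective (NormedSpace.inclusionInDoubleDualLi 𝕜) <| by
    refine (LinearMap.injective_iff_surjective_of_finrank_eq_finrank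
      (f := (NormedSpace.inclusionInDoubleDualLi 𝕜 (E := Z)).toLinearMap) ?_).1
        (NormedSpace.inclusionInDoubleDualLi 𝕜).injective
    rw [finrank_strongDual, finrank_strongDual]

theorem bidualEquiv_apply [FiniteDimensional 𝕜 Z] (z : Z) (f : StrongDual 𝕜 Z) :
    bidualEquiv 𝕜 Z z f = f z := rfl

theorem apply_bidualEquiv_symm [FiniteDimensional 𝕜 Z] (ξ : StrongDual 𝕜 (StrongDual 𝕜 Z))
    (f : StrongDual 𝕜 Z) : f ((bidualEquiv 𝕜 Z).symm ξ) = ξ f := by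
  rw [← bidualEquiv_apply, LinearIsometryEquiv.apply_symm_apply]

end LocalReflexivity

/-! ### Polynomials, adjoint operators and the trace duality -/

section Functoriality

variable {𝕜 : Type*} [RCLike 𝕜] {n : ℕ}
variable {E F G : Type*} [NormedAddCommGroup E] [NormedSpace 𝕜 E]
  [NormedAddCommGroup F] [NormedSpace 𝕜 F] [NormedAddCommGroup G] [NormedSpace 𝕜 G]

theorem polyComp_polyComp (p : HomPoly 𝕜 n G) (T : F →L[𝕜] G) (S : E →L[𝕜] F) :
    polyComp (polyComp p T) S = polyComp p (T.comp S) := rfl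

theorem polyComp_smul_left (c : 𝕜) (p : HomPoly 𝕜 n F) (T : E →L[𝕜] F) :
    polyComp (c • p) T = c • polyComp p T := rfl

theorem polyComp_smul_right (c : 𝕜) (p : HomPoly 𝕜 n F) (T : E →L[𝕜] F) :
    polyComp p (c • T) = c ^ n • polyComp p T := by
  obtain ⟨f, hf⟩ := p.2
  ext x
  change (p : F → 𝕜) (c • T x) = c ^ n • (p : F → 𝕜) (T x)
  rw [hf, hf]
  simpa using f.map_smul_univ (fun _ => c) fun _ => T x

theorem dualOp_smul (c : 𝕜) (T : E →L[𝕜] F) : dualOp (c • T) = c • dualOp T := by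
  ext f x
  simp [dualOp]

theorem norm_dualOp_le (T : E →L[𝕜] F) : ‖dualOp T‖ ≤ ‖T‖ :=
  ContinuousLinearMap.opNorm_le_bound _ (norm_nonneg _) fun f => by
    rw [mul_comm]
    exact f.opNorm_comp_le T

/-- The trace duality turns composition with an operator into composition with its adjoint. -/
theorem tracePairing_polyComp [FiniteDimensional 𝕜 E] [FiniteDimensional 𝕜 F]
    (q : HomPoly 𝕜 n F) (T : E →L[𝕜] F) (s : HomPoly 𝕜 n (StrongDual 𝕜 E)) :
    tracePairing 𝕜 n E (polyComp q T) s = tracePairing 𝕜 n F q (polyComp s (dualOp T)) := by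
  classical
  obtain ⟨c, hc⟩ := exists_sum_powPoint s
  have h1 := traceVal_eq (polyComp q T) s c hc
  have h2 := traceVal_eq q (polyComp s (dualOp T)) (c.mapDomain T) fun φ => by
    rw [Finsupp.sum_mapDomain_index (by simp) (by intros; ring)]
    exact hc _
  rw [Finsupp.sum_mapDomain_index (by simp) (by intros; ring)] at h2
  exact h1.trans h2.symm

end Functoriality

/-! ### Estimates in ideals -/

section Ideals

variable {𝕜 : Type u} [RCLike 𝕜] {n : ℕ}
variable {E F G : Type u} [NormedAddCommGroup E] [NormedSpace 𝕜 E] [CompleteSpace E]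
  [NormedAddCommGroup F] [NormedSpace 𝕜 F] [CompleteSpace F]
  [NormedAddCommGroup G] [NormedSpace 𝕜 G] [CompleteSpace G]

theorem IsBanachPolyIdeal.comp_contraction_le {Q : PolyGauge.{u} 𝕜 n} (hQ : IsBanachPolyIdeal Q)
    (p : HomPoly 𝕜 n F) {T : E →L[𝕜] F} (hT : ‖T‖ ≤ 1) : Q E (polyComp p T) ≤ Q F p := by
  rcases eq_or_ne (Q F p) ∞ with h | h
  · rw [h]; exact le_top
  have hT' : ‖T‖ₑ ≤ 1 := by
    rw [← ofReal_norm]; exact ENNReal.ofReal_le_one.2 hT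
  calc Q E (polyComp p T) ≤ Q F p * ‖T‖ₑ ^ n := hQ.comp_le E F T p h.lt_top
    _ ≤ Q F p * 1 := by gcongr; exact pow_le_one' hT' n
    _ = Q F p := mul_one _

theorem IsBanachOpIdeal.comp_contractions_le {A : OpGauge.{u} 𝕜} (hA : IsBanachOpIdeal A)
    {E₀ F₀ : Type u} [NormedAddCommGroup E₀] [NormedSpace 𝕜 E₀] [CompleteSpace E₀]
    [NormedAddCommGroup F₀] [NormedSpace 𝕜 F₀] [CompleteSpace F₀] (T : E →L[𝕜] F)
    {S : E₀ →L[𝕜] E} {R : F →L[𝕜] F₀} (hR : ‖R‖ ≤ 1) (hS : ‖S‖ ≤ 1) :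
    A E₀ F₀ (R.comp (T.comp S)) ≤ A E F T := by
  rcases eq_or_ne (A E F T) ∞ with h | h
  · rw [h]; exact le_top
  have hR' : ‖R‖ₑ ≤ 1 := by
    rw [← ofReal_norm]; exact ENNReal.ofReal_le_one.2 hR
  have hS' : ‖S‖ₑ ≤ 1 := by
    rw [← ofReal_norm]; exact ENNReal.ofReal_le_one.2 hS
  calc A E₀ F₀ (R.comp (T.comp S)) ≤ ‖R‖ₑ * A E F T * ‖S‖ₑ :=
        hA.comp_le E₀ E F F₀ S T R h.lt_top
    _ ≤ 1 * A E F T * 1 := by gcongr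
    _ = A E F T := by simp

theorem enorm_inv_ofReal {a : ℝ≥0} : ‖((a : ℝ) : 𝕜)⁻¹‖ₑ = ((a⁻¹ : ℝ≥0) : ℝ≥0∞) := by
  rw [enorm_eq_nnnorm, ENNReal.coe_inj]
  ext
  simp

/-- The defining estimate of the quotient `Q^* ∘ (A^dual)⁻¹`, freed of the normalizations of the
operator and of the test polynomial. -/
theorem enorm_tracePairing_le_compInvIdeal {Q : PolyGauge.{u} 𝕜 n} (hQ : IsBanachPolyIdeal Q)
    {A : OpGauge.{u} 𝕜} (hA : IsBanachOpIdeal A) (p : HomPoly 𝕜 n E) (T : G →L[𝕜] E)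
    (M : Submodule 𝕜 G) [FiniteDimensional 𝕜 M] (s : HomPoly 𝕜 n (StrongDual 𝕜 M))
    {a b : ℝ≥0} (ha : 0 < a) (hb : 0 < b) (hT : A.dual G E T ≤ a)
    (hs : Q (StrongDual 𝕜 M) s ≤ b) :
    ‖tracePairing 𝕜 n M (polyComp (polyComp p T) M.subtypeL) s‖ₑ ≤
      Q.adjoint.compInvIdeal A.dual E p * (b * a ^ n : ℝ≥0) := by
  have hT1 : A.dual G E (((a : ℝ) : 𝕜)⁻¹ • T) ≤ 1 := by
    unfold OpGauge.dual at hT ⊢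
    rw [dualOp_smul, (hA.extNorm _ _).smul, enorm_inv_ofReal, ENNReal.coe_inv ha.ne']
    rw [ENNReal.inv_mul_le_iff (by simpa using ha.ne') ENNReal.coe_ne_top, mul_one]
    exact hT
  have hs1 : Q (StrongDual 𝕜 M) (((b : ℝ) : 𝕜)⁻¹ • s) ≤ 1 := by
    rw [(hQ.extNorm _).smul, enorm_inv_ofReal, ENNReal.coe_inv hb.ne',
      ENNReal.inv_mul_le_iff (by simpa using hb.ne') ENNReal.coe_ne_top, mul_one]
    exact hs
  have h1 : ‖tracePairing 𝕜 n M (polyComp (polyComp p (((a : ℝ) : 𝕜)⁻¹ • T)) M.subtypeL)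
      (((b : ℝ) : 𝕜)⁻¹ • s)‖ₑ ≤ Q.adjoint.compInvIdeal A.dual E p := by
    refine le_trans ?_ (le_sSup (a := Q.adjoint G (polyComp p (((a : ℝ) : 𝕜)⁻¹ • T)))
      ⟨G, _, _, _, _, hT1, rfl⟩)
    exact le_iSup_of_le M <| le_iSup_of_le inferInstance <| le_iSup_of_le _ <|
      le_iSup_of_le hs1 le_rfl
  have ha' : ((a : ℝ) : 𝕜) ≠ 0 := by exact_mod_cast ha.ne'
  have hb' : ((b : ℝ) : 𝕜) ≠ 0 := by exact_mod_cast hb.ne'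
  have h2 : tracePairing 𝕜 n M (polyComp (polyComp p T) M.subtypeL) s =
      (((b * a ^ n : ℝ≥0) : ℝ) : 𝕜) *
      tracePairing 𝕜 n M (polyComp (polyComp p (((a : ℝ) : 𝕜)⁻¹ • T)) M.subtypeL)
        (((b : ℝ) : 𝕜)⁻¹ • s) := by
    rw [polyComp_smul_right, polyComp_smul_left]
    simp only [map_smul, LinearMap.smul_apply, smul_eq_mul, inv_pow]
    push_cast
    field_simp
  rw [h2, enorm_mul, mul_comm]
  gcongr
  rw [enorm_eq_nnnorm, ENNReal.coe_le_coe, ← NNReal.coe_le_coe]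
  simp

/-- The defining estimate of the adjoint `(Q ∘ A)^*` for a test polynomial `s ∘ S`, freed of the
normalization of the operator. -/
theorem enorm_tracePairing_le_adjoint_compIdeal {Q : PolyGauge.{u} 𝕜 n}
    {A : OpGauge.{u} 𝕜} (hA : IsBanachOpIdeal A) (p : HomPoly 𝕜 n E) (N : Submodule 𝕜 E)
    [FiniteDimensional 𝕜 N] (S : StrongDual 𝕜 N →L[𝕜] F) (s : HomPoly 𝕜 n F)
    {a : ℝ≥0} (ha : 0 < a) (hS : A (StrongDual 𝕜 N) F S ≤ a) (hs : Q F s ≤ 1) :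
    ‖tracePairing 𝕜 n N (polyComp p N.subtypeL) (polyComp s S)‖ₑ ≤
      (Q.compIdeal A).adjoint E p * (a ^ n : ℝ≥0) := by
  have hS1 : A (StrongDual 𝕜 N) F (((a : ℝ) : 𝕜)⁻¹ • S) ≤ 1 := by
    rw [(hA.extNorm _ _).smul, enorm_inv_ofReal, ENNReal.coe_inv ha.ne',
      ENNReal.inv_mul_le_iff (by simpa using ha.ne') ENNReal.coe_ne_top, mul_one]
    exact hS
  have hr : Q.compIdeal A (StrongDual 𝕜 N) (polyComp s (((a : ℝ) : 𝕜)⁻¹ • S)) ≤ 1 := by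
    refine le_trans (sInf_le ⟨F, _, _, _, _, s, hS1.trans_lt ENNReal.one_lt_top,
      hs.trans_lt ENNReal.one_lt_top, rfl, rfl⟩) ?_
    exact mul_le_one' hs (pow_le_one' hS1 n)
  have h1 : ‖tracePairing 𝕜 n N (polyComp p N.subtypeL) (polyComp s (((a : ℝ) : 𝕜)⁻¹ • S))‖ₑ ≤
      (Q.compIdeal A).adjoint E p :=
    le_iSup_of_le N <| le_iSup_of_le inferInstance <| le_iSup_of_le _ <|
      le_iSup_of_le hr le_rfl
  have ha' : ((a : ℝ) : 𝕜) ≠ 0 := by exact_mod_cast ha.ne'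
  have h2 : tracePairing 𝕜 n N (polyComp p N.subtypeL) (polyComp s S) =
      (((a ^ n : ℝ≥0) : ℝ) : 𝕜) *
      tracePairing 𝕜 n N (polyComp p N.subtypeL) (polyComp s (((a : ℝ) : 𝕜)⁻¹ • S)) := by
    rw [polyComp_smul_right]
    simp only [map_smul, smul_eq_mul, inv_pow]
    push_cast
    field_simp
  rw [h2, enorm_mul, mul_comm]
  gcongr
  rw [enorm_eq_nnnorm, ENNReal.coe_le_coe, ← NNReal.coe_le_coe]
  simp

/-- A test polynomial `s ∘ S` for `p` on the finite dimensional subspace `M` of `E`, with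
`S : M' → N` and `N` finite dimensional, is a test polynomial for `p ∘ T` on `N'`, where
`T : N' → E` is the composition of `S' : N' → M'' = M` with the inclusion of `M`: up to the
identification `N'' = N`, the adjoint of `T` is the composition of `S` with the restriction
`E' → M'`. -/
theorem enorm_tracePairing_comp_le_compInvIdeal {Q : PolyGauge.{u} 𝕜 n} (hQ : IsBanachPolyIdeal Q)
    {A : OpGauge.{u} 𝕜} (hA : IsBanachOpIdeal A) (p : HomPoly 𝕜 n E) (M : Submodule 𝕜 E)
    [FiniteDimensional 𝕜 M] {N : Type u} [NormedAddCommGroup N] [NormedSpace 𝕜 N]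
    [CompleteSpace N] [FiniteDimensional 𝕜 N] (S : StrongDual 𝕜 M →L[𝕜] N) (s : HomPoly 𝕜 n N)
    {a b : ℝ≥0} (ha : 0 < a) (hb : 0 < b) (hS : A (StrongDual 𝕜 M) N S ≤ a) (hs : Q N s ≤ b) :
    ‖tracePairing 𝕜 n M (polyComp p M.subtypeL) (polyComp s S)‖ₑ ≤
      Q.adjoint.compInvIdeal A.dual E p * (b * a ^ n : ℝ≥0) := by
  let κM : StrongDual 𝕜 (StrongDual 𝕜 M) →L[𝕜] M :=
    (bidualEquiv 𝕜 M).symm.toContinuousLinearEquiv.toContinuousLinearMap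
  let κN : N →L[𝕜] StrongDual 𝕜 (StrongDual 𝕜 N) :=
    (bidualEquiv 𝕜 N).toContinuousLinearEquiv.toContinuousLinearMap
  let κN' : StrongDual 𝕜 (StrongDual 𝕜 N) →L[𝕜] N :=
    (bidualEquiv 𝕜 N).symm.toContinuousLinearEquiv.toContinuousLinearMap
  have hκN : ‖κN‖ ≤ 1 := ContinuousLinearMap.opNorm_le_bound _ zero_le_one fun x => by
    rw [one_mul]; exact ((bidualEquiv 𝕜 N).norm_map x).le
  have hκN' : ‖κN'‖ ≤ 1 := ContinuousLinearMap.opNorm_le_bound _ zero_le_one fun x => by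
    rw [one_mul]; exact ((bidualEquiv 𝕜 N).symm.norm_map x).le
  let R : StrongDual 𝕜 N →L[𝕜] M := κM.comp (dualOp S)
  have hR : ∀ (φ : StrongDual 𝕜 M) (ν : StrongDual 𝕜 N), φ (R ν) = ν (S φ) := fun φ ν =>
    apply_bidualEquiv_symm _ _
  let T : StrongDual 𝕜 N →L[𝕜] E := M.subtypeL.comp R
  have hT : A.dual _ _ T ≤ a := by
    have e : dualOp T = κN.comp (S.comp (dualOp M.subtypeL)) := by
      ext φ ν
      exact hR (dualOp M.subtypeL φ) ν
    change A _ _ (dualOp T) ≤ a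
    rw [e]
    refine (hA.comp_contractions_le S hκN ?_).trans hS
    exact (norm_dualOp_le _).trans (Submodule.norm_subtypeL_le M)
  let j : StrongDual 𝕜 N →L[𝕜] (⊤ : Submodule 𝕜 (StrongDual 𝕜 N)) :=
    (ContinuousLinearMap.id 𝕜 _).codRestrict ⊤ fun _ => Submodule.mem_top
  have hj : ‖j‖ ≤ 1 := ContinuousLinearMap.opNorm_le_bound _ zero_le_one fun x => by
    rw [one_mul]; exact le_rfl
  have hs' : Q _ (polyComp s (κN'.comp (dualOp j))) ≤ b := by
    refine (hQ.comp_contraction_le s ?_).trans hs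
    refine (ContinuousLinearMap.opNorm_comp_le _ _).trans ?_
    exact mul_le_one₀ hκN' (norm_nonneg _) ((norm_dualOp_le _).trans hj)
  have key := enorm_tracePairing_le_compInvIdeal hQ hA p T ⊤ _ ha hb hT hs'
  have e1 : polyComp (polyComp p T) (⊤ : Submodule 𝕜 (StrongDual 𝕜 N)).subtypeL =
    polyComp (polyComp p M.subtypeL) (R.comp (⊤ : Submodule 𝕜 (StrongDual 𝕜 N)).subtypeL) := rfl
  have e2 : (κN'.comp (dualOp j)).comp
      (dualOp (R.comp (⊤ : Submodule 𝕜 (StrongDual 𝕜 N)).subtypeL)) = S := by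
    ext φ
    apply (bidualEquiv 𝕜 N).injective
    refine ((bidualEquiv 𝕜 N).apply_symm_apply _).trans ?_
    ext ν
    exact hR φ ν
  rwa [e1, tracePairing_polyComp, polyComp_polyComp, e2] at key

theorem le_apply_zero_of_forall_pos {f : ℝ≥0 → ℝ≥0} (hf : Continuous f) {x : ℝ≥0}
    (h : ∀ δ, 0 < δ → x ≤ f δ) : x ≤ f 0 :=
  ge_of_tendsto ((hf.tendsto 0).mono_left nhdsWithin_le_nhds)
    (Filter.eventually_of_mem (self_mem_nhdsWithin : Set.Ioi 0 ∈ 𝓝[>] (0 : ℝ≥0)) h)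

/-! ### The two inequalities -/

theorem adjoint_compIdeal_le_compInvIdeal {Q : PolyGauge.{u} 𝕜 n} (hQ : IsBanachPolyIdeal Q)
    {A : OpGauge.{u} 𝕜} (hA : IsBanachOpIdeal A) (hr : A.IsRightAccessible) (p : HomPoly 𝕜 n E) :
    (Q.compIdeal A).adjoint E p ≤ Q.adjoint.compInvIdeal A.dual E p := by
  refine iSup_le fun M => iSup_le fun _ => iSup_le fun r => iSup_le fun hr1 => ?_
  generalize hC : Q.adjoint.compInvIdeal A.dual E p = C
  rcases eq_or_ne C ∞ with h | h
  · rw [h]; exact le_top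
  lift C to ℝ≥0 using h
  rw [enorm_eq_nnnorm, ENNReal.coe_le_coe]
  have key : ∀ δ : ℝ≥0, 0 < δ →
      ‖tracePairing 𝕜 n M (polyComp p M.subtypeL) r‖₊ ≤ C * ((1 + δ) * (1 + δ) ^ n) := by
    intro δ hδ
    have hlt : Q.compIdeal A _ r < ((1 + δ : ℝ≥0) : ℝ≥0∞) :=
      hr1.trans_lt (by exact_mod_cast lt_add_of_pos_right 1 hδ)
    obtain ⟨c, ⟨F, _, _, _, T, q, hT, hq, rfl, rfl⟩, hc⟩ := sInf_lt_iff.1 hlt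
    obtain ⟨N, _, S, hTS, hS⟩ := hr _ _ T δ hδ
    -- By right-accessibility `r = q ∘ T` factors through a finite dimensional space.
    have hqN : Q N (polyComp q N.subtypeL) ≤ Q F q :=
      hQ.comp_contraction_le q (Submodule.norm_subtypeL_le N)
    generalize Q F q = b at *
    generalize A _ _ T = a at *
    lift a to ℝ≥0 using hT.ne
    lift b to ℝ≥0 using hq.ne
    -- Strict upper bounds of the norms are used because the norms themselves may vanish.
    have h1 : ∀ η : ℝ≥0, 0 < η →
        ‖tracePairing 𝕜 n M (polyComp p M.subtypeL) (polyComp q T)‖₊ ≤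
          C * ((b + η) * ((1 + δ) * a + η) ^ n) := by
      intro η hη
      have := enorm_tracePairing_comp_le_compInvIdeal hQ hA p M S (polyComp q N.subtypeL)
        (a := (1 + δ) * a + η) (b := b + η) (by positivity) (by positivity)
        (hS.trans (by push_cast; exact le_self_add)) (hqN.trans (by push_cast; exact le_self_add))
      rw [hC, polyComp_polyComp, ← hTS, enorm_eq_nnnorm, ← ENNReal.coe_mul,
        ENNReal.coe_le_coe] at this
      exact this
    have h2 := le_apply_zero_of_forall_pos (by fun_prop) h1
    have h3 : b * a ^ n ≤ 1 + δ := by exact_mod_cast hc.le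
    calc _ ≤ C * ((b + 0) * ((1 + δ) * a + 0) ^ n) := h2
      _ = C * ((b * a ^ n) * (1 + δ) ^ n) := by rw [add_zero, add_zero, mul_pow]; ring
      _ ≤ C * ((1 + δ) * (1 + δ) ^ n) := by gcongr
  simpa using le_apply_zero_of_forall_pos (by fun_prop) key

theorem compInvIdeal_le_adjoint_compIdeal {Q : PolyGauge.{u} 𝕜 n}
    {A : OpGauge.{u} 𝕜} (hA : IsBanachOpIdeal A) (hd : A.dual.IsRightAccessible)
    (p : HomPoly 𝕜 n E) :
    Q.adjoint.compInvIdeal A.dual E p ≤ (Q.compIdeal A).adjoint E p := by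
  refine sSup_le ?_
  rintro _ ⟨G, _, _, _, T, hT, rfl⟩
  refine iSup_le fun M => iSup_le fun _ => iSup_le fun s => iSup_le fun hs => ?_
  generalize hC : (Q.compIdeal A).adjoint E p = C
  rcases eq_or_ne C ∞ with h | h
  · rw [h]; exact le_top
  lift C to ℝ≥0 using h
  rw [enorm_eq_nnnorm, ENNReal.coe_le_coe]
  have key : ∀ δ : ℝ≥0, 0 < δ →
      ‖tracePairing 𝕜 n M (polyComp (polyComp p T) M.subtypeL) s‖₊ ≤ C * (1 + δ) ^ n := by
    intro δ hδ
    -- The restriction of `T` to `M` factors through a finite dimensional subspace `N` of `E` with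
    -- control of the adjoint of the first factor, which carries the test polynomial over to `N`.
    obtain ⟨N, _, S, hTS, hS⟩ := hd _ _ (T.comp M.subtypeL) δ hδ
    have hTM : A.dual _ _ (T.comp M.subtypeL) ≤ 1 := by
      refine le_trans ?_ hT
      change A _ _ ((dualOp M.subtypeL).comp
        ((dualOp T).comp (ContinuousLinearMap.id 𝕜 (StrongDual 𝕜 E)))) ≤ A _ _ (dualOp T)
      exact hA.comp_contractions_le (dualOp T)
        ((norm_dualOp_le _).trans (Submodule.norm_subtypeL_le M)) ContinuousLinearMap.norm_id_le
    have hS' : A _ _ (dualOp S) ≤ ((1 + δ : ℝ≥0) : ℝ≥0∞) := by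
      refine hS.trans ?_
      push_cast
      exact mul_le_of_le_one_right' hTM
    have := enorm_tracePairing_le_adjoint_compIdeal hA p N (dualOp S) s (by positivity) hS' hs
    rw [hC, ← tracePairing_polyComp, polyComp_polyComp, ← hTS, enorm_eq_nnnorm, ← ENNReal.coe_mul,
      ENNReal.coe_le_coe] at this
    exact this
  simpa using le_apply_zero_of_forall_pos (by fun_prop) key

/-- If `A` is left-accessible, then `A^dual` is right-accessible. A factorization `T' = S ∘ Q_L` of
the adjoint of `T : M → F` through `F' / L` yields `T'' : M'' → (F' / L)' → F''`, and local
reflexivity moves the finite dimensional space `(F' / L)'` from `F''` into `F`, without moving the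
image of `T`. -/
theorem IsBanachOpIdeal.isRightAccessible_dual {A : OpGauge.{u} 𝕜} (hA : IsBanachOpIdeal A)
    (hl : A.IsLeftAccessible) : A.dual.IsRightAccessible := by
  intro M F _ _ _ _ _ _ _ T ε hε
  -- two losses of a factor `1 + δ`
  obtain ⟨δ, hδ, hδε⟩ : ∃ δ : ℝ≥0, 0 < δ ∧ (1 + δ) * (1 + δ) ≤ 1 + ε := by
    have h1 : Filter.Tendsto (fun δ : ℝ≥0 => (1 + δ) * (1 + δ)) (𝓝[>] 0) (𝓝 1) := by
      have : Continuous fun δ : ℝ≥0 => (1 + δ) * (1 + δ) := by fun_prop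
      simpa using (this.tendsto 0).mono_left nhdsWithin_le_nhds
    obtain ⟨δ, h, h'⟩ := ((h1.eventually_lt_const (lt_add_of_pos_right 1 hε)).and
      (self_mem_nhdsWithin : Set.Ioi 0 ∈ 𝓝[>] (0 : ℝ≥0))).exists
    exact ⟨δ, h', h.le⟩
  obtain ⟨L, _, _, S, hTS, hS⟩ := hl _ _ (dualOp T) δ hδ
  let V := StrongDual 𝕜 F ⧸ L
  have hmk : ‖L.mkQL‖ ≤ 1 := ContinuousLinearMap.opNorm_le_bound _ zero_le_one fun x => by
    rw [one_mul]; exact Submodule.Quotient.norm_mk_le L x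
  let w : M →L[𝕜] StrongDual 𝕜 V := (dualOp S).comp (NormedSpace.inclusionInDoubleDual 𝕜 M)
  obtain ⟨R, hR, hRw⟩ := exists_operator_of_bidual (dualOp L.mkQL)
    ((norm_dualOp_le _).trans hmk) w T (fun m => by
      ext f
      have : dualOp T f m = S (L.mkQL f) m := by rw [hTS]; rfl
      exact this.symm) (ε := δ) (by exact_mod_cast hδ)
  let N : Submodule 𝕜 F := LinearMap.range R.toLinearMap
  have hN : FiniteDimensional 𝕜 N := inferInstanceAs
    (FiniteDimensional 𝕜 (LinearMap.range R.toLinearMap))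
  let R₁ : StrongDual 𝕜 V →L[𝕜] N := R.codRestrict N fun x => ⟨x, rfl⟩
  have hR₁ : ‖R₁‖ ≤ 1 + δ := ContinuousLinearMap.opNorm_le_bound _ (by positivity) fun x =>
    (R.le_opNorm x).trans (by gcongr)
  refine ⟨N, hN, R₁.comp w, ?_, ?_⟩
  · rw [← hRw]; rfl
  -- the ideal inequality is available only for operators of finite norm
  rcases eq_or_ne (A.dual M F T) ∞ with h | h
  · rw [h, ENNReal.mul_top (by simp)]; exact le_top
  let κ : StrongDual 𝕜 (StrongDual 𝕜 V) →L[𝕜] V :=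
    (bidualEquiv 𝕜 V).symm.toContinuousLinearEquiv.toContinuousLinearMap
  have hκ : ‖κ‖ ≤ 1 := ContinuousLinearMap.opNorm_le_bound _ zero_le_one fun x => by
    rw [one_mul]; exact ((bidualEquiv 𝕜 V).symm.norm_map x).le
  have e : dualOp (R₁.comp w) =
      (ContinuousLinearMap.id 𝕜 (StrongDual 𝕜 M)).comp (S.comp (κ.comp (dualOp R₁))) := by
    ext ν m
    exact (apply_bidualEquiv_symm (dualOp R₁ ν) (w m)).symm
  have hκR : ‖κ.comp (dualOp R₁)‖ₑ ≤ 1 + δ := by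
    have h1 : ‖κ.comp (dualOp R₁)‖₊ ≤ 1 + δ := by
      refine (ContinuousLinearMap.opNorm_comp_le _ _).trans ?_
      refine (mul_le_mul hκ ((norm_dualOp_le _).trans hR₁) (norm_nonneg _) zero_le_one).trans ?_
      simp
    rw [enorm_eq_nnnorm]
    exact_mod_cast h1
  have hid : ‖ContinuousLinearMap.id 𝕜 (StrongDual 𝕜 M)‖ₑ ≤ 1 := by
    rw [← ofReal_norm]
    exact ENNReal.ofReal_le_one.2 ContinuousLinearMap.norm_id_le
  have hfin : A V (StrongDual 𝕜 M) S < ∞ :=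
    hS.trans_lt (ENNReal.mul_lt_top (by simp) h.lt_top)
  change A _ _ (dualOp (R₁.comp w)) ≤ (1 + ε) * A.dual M F T
  rw [e]
  calc _ ≤ ‖ContinuousLinearMap.id 𝕜 (StrongDual 𝕜 M)‖ₑ * A V (StrongDual 𝕜 M) S *
        ‖κ.comp (dualOp R₁)‖ₑ := hA.comp_le _ _ _ _ _ _ _ hfin
    _ ≤ 1 * ((1 + δ) * A.dual M F T) * (1 + δ) := by gcongr; exact hS
    _ = ((1 + δ) * (1 + δ)) * A.dual M F T := by ring
    _ ≤ (1 + ε) * A.dual M F T := by gcongr; exact_mod_cast hδε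

end Ideals

end BanachIdeals

theorem mainTheorem6 {𝕜 : Type u} [RCLike 𝕜] (n : ℕ)
    (Q : BanachIdeals.PolyGauge.{u} 𝕜 n) (hQ : BanachIdeals.IsBanachPolyIdeal Q)
    (A : BanachIdeals.OpGauge.{u} 𝕜) (hA : BanachIdeals.IsBanachOpIdeal A)
    (h : (A.IsMaximal ∧ A.IsAccessible) ∨ (A.IsRightAccessible ∧ A.dual.IsRightAccessible)) :
    (Q.compIdeal A).adjoint.IsometricallyEq (Q.adjoint.compInvIdeal A.dual) := by
  have h' : A.IsRightAccessible ∧ A.dual.IsRightAccessible :=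
    h.elim (fun h => ⟨h.2.1, hA.isRightAccessible_dual h.2.2⟩) id
  intro E _ _ _ p
  have heq := (BanachIdeals.adjoint_compIdeal_le_compInvIdeal hQ hA h'.1 p).antisymm
    (BanachIdeals.compInvIdeal_le_adjoint_compIdeal (Q := Q) hA h'.2 p)
  exact ⟨by rw [BanachIdeals.PolyGauge.Mem, BanachIdeals.PolyGauge.Mem, heq], fun _ => heq⟩
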